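/- Let $n\ge 2$, and let $K\subset\mathbb R^n$ be a convex body, that is, a compact convex set with non-empty interior. Suppose that $\frac1D \mathbf B^n\subset K\subset \mathbf B^n$ for some real $D>1$, where $\mathbf B^n$ is the closed Euclidean unit ball centered at the origin. A direction $u\in\mathbb S^{n-1}$ illuminates a boundary point $b$ of $K$ if the ray $\{b+\lambda u:\lambda>0\}$ meets the interior of $K$; the illumination number ${\rm i}(K)$ is the minimum number of directions such that each boundary point of $K$ is illuminated by at least one of them. Let $\Omega_{n-1}(\varphi)$ denote the measure of a closed spherical cap $\{v\in\mathbb S^{n-1}:\sphericalangle(u,v)\le\varphi\}$ (which is the same for every center $u\in\mathbb S^{n-1}$) with respect to the rotation-invariant probability measure on $\mathbb S^{n-1}$. Then ${\rm i}(K)$ is finite and $$ {\rm i}(K)\le\frac{n\ln n+n\ln\ln n+5n}{\Omega_{n-1}(\alpha)},\qquad \alpha=\arcsin(1/D). $$ -/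

import Mathlib

open MeasureTheory Metric

/-- The unit sphere `S^{n-1}` of `ℝ^n`, as a type. -/
abbrev UnitSphere (n : ℕ) : Type :=
  sphere (0 : EuclideanSpace ℝ (Fin n)) 1

/-- A convex body in `ℝ^n`: a compact convex set with non-empty interior. -/
structure IsConvexBody {n : ℕ} (K : Set (EuclideanSpace ℝ (Fin n))) : Prop where
  isCompact : IsCompact K
  convex : Convex ℝ K
  nonempty_interior : (interior K).Nonempty

/-- The direction `u` illuminates `K` at the point `b`: the open ray from `b` in the direction `u`
meets the interior of `K`. -/
def Illuminates {n : ℕ} (K : Set (EuclideanSpace ℝ (Fin n))) (u : UnitSphere n)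
    (b : EuclideanSpace ℝ (Fin n)) : Prop :=
  ∃ t : ℝ, 0 < t ∧ b + t • (u : EuclideanSpace ℝ (Fin n)) ∈ interior K

/-- A set `A` of directions illuminates `K`: each boundary point of `K` is illuminated by
some direction in `A`. -/
def IlluminatedBy {n : ℕ} (K : Set (EuclideanSpace ℝ (Fin n))) (A : Set (UnitSphere n)) : Prop :=
  ∀ b ∈ frontier K, ∃ u ∈ A, Illuminates K u b

/-- The illumination number of `K`: the least number of directions that illuminate `K`
(`⊤` if no finite set of directions does). -/
noncomputable def illuminationNumber {n : ℕ} (K : Set (EuclideanSpace ℝ (Fin n))) : ℕ∞ :=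
  sInf {m : ℕ∞ | ∃ A : Set (UnitSphere n), IlluminatedBy K A ∧ A.encard = m}

/-- The closed spherical cap with centre `u` and angular radius `φ`. -/
def sphericalCap {n : ℕ} (u : UnitSphere n) (φ : ℝ) : Set (UnitSphere n) :=
  {v | InnerProductGeometry.angle (u : EuclideanSpace ℝ (Fin n)) v ≤ φ}

/-- The normalized surface (Lebesgue) measure on the unit sphere of `ℝ^n`. -/
noncomputable def sphereProb (n : ℕ) : Measure (UnitSphere n) :=
  ((volume : Measure (EuclideanSpace ℝ (Fin n))).toSphere Set.univ)⁻¹ •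
    (volume : Measure (EuclideanSpace ℝ (Fin n))).toSphere

/-- The normalized measure of the cap with centre `u` and angular radius `φ` on the unit sphere
of `ℝ^n`. By rotation invariance it does not depend on `u`. -/
noncomputable def capMeasure {n : ℕ} (u : UnitSphere n) (φ : ℝ) : ℝ :=
  (sphereProb n).real (sphericalCap u φ)

/-! The proof combines an elementary geometric observation with Rogers' covering method.

A ray that leaves a boundary point `b` of `K` at an angle less than `α = arcsin (1 / D)` with the
direction of the origin passes the origin at distance less than `‖b‖ sin α ≤ 1 / D`, so it meets the
inscribed ball (`illuminates_of_angle_lt_arcsin`). The centres of any covering of the sphere by open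
caps of angular radius `α` therefore illuminate `K`, and the theorem reduces to an economical
covering of the sphere by caps of radius `φ = α`.

By averaging, some cap covers at least the fraction `Ω` of any given set, where `Ω` is the measure
of the cap (`exists_measureReal_diff_sphericalCap_le`). Hence `N` caps of radius `(1 - ε) φ` can be
chosen so that the set `U` they miss has measure at most `(1 - Ω((1 - ε) φ)) ^ N`. Take a maximal
family of disjoint open caps of radius `ε φ` inside `U` (`exists_saturated_packing`); its size is
at most the measure of `U` divided by `Ω(ε φ)`. The caps of radius `φ` about all these centres cover
the sphere, since the cap of radius `ε φ` about a point either leaves `U` or meets a cap of the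
packing, and `2 ε ≤ 1`.

The count needs only the scaling estimate `t ^ n * Ω(φ) ≤ Ω(t φ)` for `t ≤ 1`
(`pow_mul_capMeasure_le`). The measure of a cap is proportional to the volume of the solid sector
over it, and the map of `ℝ^n` that multiplies the angle with the centre of the cap by `t`, keeping
norm and meridian, shrinks no distance by more than the factor `t`
(`mul_dist_le_dist_polarContraction`), so it shrinks no volume by more than the factor `t ^ n`. The
exponent `n - 1` would be sharp, but `n` is enough: with `ε = 1 / (n (ln n + 1))` and
`N ≈ (n ln n + n ln ln n + 5 n - 2) / Ω(φ)` the packing contributes at most `1 / Ω(φ)` further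
caps (`exp_neg_le_pow`). -/

/-! ### Caps and the solid sectors over them -/

lemma continuous_angle_right {n : ℕ} (u : UnitSphere n) : Continuous fun v : UnitSphere n =>
    InnerProductGeometry.angle (u : EuclideanSpace ℝ (Fin n)) v := by
  refine continuous_iff_continuousAt.2 fun v => ?_
  have h := InnerProductGeometry.continuousAt_angle
    (x := ((u : EuclideanSpace ℝ (Fin n)), (v : EuclideanSpace ℝ (Fin n))))
    (ne_zero_of_mem_unit_sphere u) (ne_zero_of_mem_unit_sphere v)
  exact ContinuousAt.comp (f := fun v : UnitSphere n =>
    ((u : EuclideanSpace ℝ (Fin n)), (v : EuclideanSpace ℝ (Fin n)))) h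
    (by fun_prop)

lemma isClosed_sphericalCap {n : ℕ} (u : UnitSphere n) (φ : ℝ) :
    IsClosed (sphericalCap u φ) :=
  isClosed_le (continuous_angle_right u) continuous_const

/-- The solid sector over the cap with centre `u` and angular radius `φ`: the points of the open
unit ball, other than the origin, whose direction lies in the cap. -/
def solidSector {n : ℕ} (u : UnitSphere n) (φ : ℝ) : Set (EuclideanSpace ℝ (Fin n)) :=
  {z | 0 < ‖z‖ ∧ ‖z‖ < 1 ∧ InnerProductGeometry.angle (u : EuclideanSpace ℝ (Fin n)) z ≤ φ}

lemma toSphere_sphericalCap {n : ℕ} (u : UnitSphere n) (φ : ℝ) :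
    (volume : Measure (EuclideanSpace ℝ (Fin n))).toSphere (sphericalCap u φ) =
      n * volume (solidSector u φ) := by
  rw [Measure.toSphere_apply' _ (isClosed_sphericalCap u φ).measurableSet,
    finrank_euclideanSpace_fin]
  congr 2
  ext z
  rw [Set.mem_smul]
  constructor
  · rintro ⟨r, ⟨hr0, hr1⟩, _, ⟨v, hv, rfl⟩, rfl⟩
    have hn : ‖r • (v : EuclideanSpace ℝ (Fin n))‖ = r := by
      rw [norm_smul, norm_eq_of_mem_sphere, Real.norm_of_nonneg hr0.le, mul_one]
    refine ⟨by rwa [hn], by rwa [hn], ?_⟩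
    rwa [InnerProductGeometry.angle_smul_right_of_pos _ _ hr0]
  · rintro ⟨h0, h1, hφ⟩
    refine ⟨‖z‖, ⟨h0, h1⟩, ‖z‖⁻¹ • z, ⟨⟨‖z‖⁻¹ • z, ?_⟩, ?_, rfl⟩, smul_inv_smul₀ h0.ne' z⟩
    · rw [mem_sphere_zero_iff_norm, norm_smul, norm_inv, norm_norm, inv_mul_cancel₀ h0.ne']
    · change InnerProductGeometry.angle _ (‖z‖⁻¹ • z) ≤ φ
      rwa [InnerProductGeometry.angle_smul_right_of_pos _ _ (inv_pos.2 h0)]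

/-- A reflection carries any point of the sphere to any other. -/
lemma volume_solidSector_eq {n : ℕ} (u v : UnitSphere n) (φ : ℝ) :
    volume (solidSector u φ) = volume (solidSector v φ) := by
  set R := (ℝ ∙ ((u : EuclideanSpace ℝ (Fin n)) - v))ᗮ.reflection with hR
  have hRu : R u = v := Submodule.reflection_sub (by simp)
  have hpre : R ⁻¹' solidSector v φ = solidSector u φ := by
    ext z
    have hz := R.toLinearIsometry.angle_map (u : EuclideanSpace ℝ (Fin n)) z
    simp only [LinearIsometryEquiv.coe_toLinearIsometry, hRu] at hz
    simp [solidSector, hz]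
  rw [← hpre]
  exact R.measurePreserving.measure_preimage_equiv (f := R.toMeasurableEquiv) _

lemma sphereProb_sphericalCap {n : ℕ} (u : UnitSphere n) (φ : ℝ) :
    sphereProb n (sphericalCap u φ) =
      ((volume : Measure (EuclideanSpace ℝ (Fin n))).toSphere Set.univ)⁻¹ *
        (n * volume (solidSector u φ)) := by
  rw [sphereProb, Measure.smul_apply, toSphere_sphericalCap, smul_eq_mul]

lemma sphereProb_sphericalCap_eq {n : ℕ} (u v : UnitSphere n) (φ : ℝ) :
    sphereProb n (sphericalCap u φ) = sphereProb n (sphericalCap v φ) := by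
  rw [sphereProb_sphericalCap, sphereProb_sphericalCap, volume_solidSector_eq u v]

lemma capMeasure_eq {n : ℕ} (u v : UnitSphere n) (φ : ℝ) : capMeasure u φ = capMeasure v φ := by
  rw [capMeasure, capMeasure, measureReal_def, measureReal_def, sphereProb_sphericalCap_eq u v]

lemma ne_zero_of_unitSphere {n : ℕ} (u : UnitSphere n) : n ≠ 0 := by
  rintro rfl
  exact ne_zero_of_mem_unit_sphere u (Subsingleton.elim _ _)

lemma isProbabilityMeasure_sphereProb {n : ℕ} (hn : n ≠ 0) :
    IsProbabilityMeasure (sphereProb n) := by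
  constructor
  rw [sphereProb, Measure.smul_apply, smul_eq_mul]
  refine ENNReal.inv_mul_cancel ?_ (measure_ne_top _ _)
  rw [Measure.toSphere_apply_univ, finrank_euclideanSpace_fin]
  exact mul_ne_zero (by simpa using hn) (measure_ball_pos _ _ one_pos).ne'

/-! ### Contracting a cap towards its centre -/

lemma mul_sin_le_sin_mul {t x : ℝ} (ht0 : 0 ≤ t) (ht1 : t ≤ 1) (hx0 : 0 ≤ x)
    (hx : x ≤ Real.pi) : t * Real.sin x ≤ Real.sin (t * x) := by
  have h := strictConcaveOn_sin_Icc.concaveOn.2 (⟨hx0, hx⟩ : x ∈ Set.Icc 0 Real.pi)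
    (⟨le_rfl, Real.pi_pos.le⟩ : (0 : ℝ) ∈ Set.Icc 0 Real.pi) ht0 (sub_nonneg.2 ht1)
    (by ring)
  simpa using h

lemma sq_mul_one_sub_cos_le {t x : ℝ} (ht0 : 0 ≤ t) (ht1 : t ≤ 1) (hx : |x| ≤ Real.pi) :
    t ^ 2 * (1 - Real.cos x) ≤ 1 - Real.cos (t * x) := by
  have key : ∀ y : ℝ, 1 - Real.cos y = 2 * Real.sin (|y| / 2) ^ 2 := fun y => by
    rw [← Real.cos_abs y, Real.sin_sq_eq_half_sub, mul_div_cancel₀ _ two_ne_zero]; ring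
  rw [key, key, abs_mul, abs_of_nonneg ht0, mul_div_assoc]
  have h0 : 0 ≤ |x| / 2 := by positivity
  have h1 : |x| / 2 ≤ Real.pi := by linarith [abs_nonneg x]
  have h := mul_sin_le_sin_mul ht0 ht1 h0 h1
  have hs := mul_nonneg ht0 (Real.sin_nonneg_of_nonneg_of_le_pi h0 h1)
  nlinarith [pow_le_pow_left₀ hs h 2]

/-- The spherical contraction inequality: if the polar distances `θ`, `τ` of two points of the
sphere are multiplied by `t ≤ 1` while the cosine `c` of the angle between their meridians is
kept, then their chordal distance does not fall below `t` times its value. The radii `a`, `b` extend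
this to the whole space. -/
lemma sq_mul_chord_le {t θ τ a b c : ℝ} (ht0 : 0 ≤ t) (ht1 : t ≤ 1) (hθ0 : 0 ≤ θ)
    (hθ : θ ≤ Real.pi) (hτ0 : 0 ≤ τ) (hτ : τ ≤ Real.pi) (ha : 0 ≤ a) (hb : 0 ≤ b) (hc : c ≤ 1) :
    t ^ 2 * (a ^ 2 + b ^ 2 - 2 * a * b *
        (Real.cos θ * Real.cos τ + Real.sin θ * Real.sin τ * c)) ≤
      a ^ 2 + b ^ 2 - 2 * a * b *
        (Real.cos (t * θ) * Real.cos (t * τ) + Real.sin (t * θ) * Real.sin (t * τ) * c) := by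
  have h1 := sq_mul_one_sub_cos_le ht0 ht1 (x := θ - τ) (by rw [abs_le]; constructor <;> linarith)
  rw [mul_sub t, Real.cos_sub, Real.cos_sub] at h1
  have h2 : (t * Real.sin θ) * (t * Real.sin τ) ≤ Real.sin (t * θ) * Real.sin (t * τ) :=
    mul_le_mul (mul_sin_le_sin_mul ht0 ht1 hθ0 hθ) (mul_sin_le_sin_mul ht0 ht1 hτ0 hτ)
      (mul_nonneg ht0 (Real.sin_nonneg_of_nonneg_of_le_pi hτ0 hτ))
      (Real.sin_nonneg_of_nonneg_of_le_pi (by positivity) (by nlinarith))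
  have h3 := mul_le_mul_of_nonneg_right h2 (sub_nonneg.2 hc)
  have h4 := mul_le_mul_of_nonneg_left (add_le_add h1 h3) (mul_nonneg ha hb)
  have h5 : t ^ 2 * (a - b) ^ 2 ≤ (a - b) ^ 2 :=
    mul_le_of_le_one_left (sq_nonneg _) (pow_le_one₀ ht0 ht1)
  linear_combination h5 + 2 * h4

section Contraction
variable {n : ℕ} (u : UnitSphere n)

/-- The unit tangent vector at `u` pointing along the meridian through `x`; it is `0` if `x` is a
multiple of `u`. -/
noncomputable def meridian (x : EuclideanSpace ℝ (Fin n)) : EuclideanSpace ℝ (Fin n) :=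
  ‖x - inner ℝ (u : EuclideanSpace ℝ (Fin n)) x • (u : EuclideanSpace ℝ (Fin n))‖⁻¹ •
    (x - inner ℝ (u : EuclideanSpace ℝ (Fin n)) x • (u : EuclideanSpace ℝ (Fin n)))

/-- The map that keeps the norm and the meridian of a point and multiplies its angle with `u`
by `t`. On the ray opposite to `u`, where there is no meridian, the norm is not kept; the lemmas
below assume that the angle is less than `π`. -/
noncomputable def polarContraction (t : ℝ) (x : EuclideanSpace ℝ (Fin n)) :
    EuclideanSpace ℝ (Fin n) :=
  ‖x‖ • (Real.cos (t * InnerProductGeometry.angle (u : EuclideanSpace ℝ (Fin n)) x) •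
      (u : EuclideanSpace ℝ (Fin n)) +
    Real.sin (t * InnerProductGeometry.angle (u : EuclideanSpace ℝ (Fin n)) x) • meridian u x)

lemma inner_meridian (x : EuclideanSpace ℝ (Fin n)) :
    inner ℝ (u : EuclideanSpace ℝ (Fin n)) (meridian u x) = 0 := by
  rw [meridian, inner_smul_right, inner_sub_right, inner_smul_right,
    real_inner_self_eq_norm_sq, norm_eq_of_mem_sphere]
  ring

lemma norm_meridian_le (x : EuclideanSpace ℝ (Fin n)) : ‖meridian u x‖ ≤ 1 := by
  rw [meridian, norm_smul, norm_inv, norm_norm]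
  exact inv_mul_le_one

lemma norm_sub_inner_smul (x : EuclideanSpace ℝ (Fin n)) :
    ‖x - inner ℝ (u : EuclideanSpace ℝ (Fin n)) x • (u : EuclideanSpace ℝ (Fin n))‖ =
      ‖x‖ * Real.sin (InnerProductGeometry.angle (u : EuclideanSpace ℝ (Fin n)) x) := by
  rw [← sq_eq_sq₀ (norm_nonneg _)
    (mul_nonneg (norm_nonneg _) (InnerProductGeometry.sin_angle_nonneg _ _)), norm_sub_sq_real,
    inner_smul_right, norm_smul, norm_eq_of_mem_sphere, real_inner_comm x, mul_pow,
    mul_pow, Real.sin_sq]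
  have h := InnerProductGeometry.cos_angle_mul_norm_mul_norm (u : EuclideanSpace ℝ (Fin n)) x
  rw [norm_eq_of_mem_sphere, one_mul, real_inner_comm] at h
  rw [Real.norm_eq_abs, sq_abs, ← h]
  ring

/-- With `t = 1` the polar contraction is the identity: polar coordinates represent the point. -/
lemma polarContraction_one (x : EuclideanSpace ℝ (Fin n)) : polarContraction u 1 x = x := by
  have h := InnerProductGeometry.cos_angle_mul_norm_mul_norm (u : EuclideanSpace ℝ (Fin n)) x
  rw [norm_eq_of_mem_sphere, one_mul] at h
  rw [polarContraction, one_mul, smul_add, smul_smul, smul_smul, mul_comm ‖x‖ (Real.cos _), h,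
    ← norm_sub_inner_smul, meridian]
  by_cases h0 : ‖x - inner ℝ (u : EuclideanSpace ℝ (Fin n)) x • (u : EuclideanSpace ℝ (Fin n))‖ = 0
  · rw [h0, zero_smul, add_zero]
    exact (sub_eq_zero.1 (norm_eq_zero.1 h0)).symm
  · rw [smul_inv_smul₀ h0, add_sub_cancel]

lemma inner_polarContraction (t : ℝ) (x y : EuclideanSpace ℝ (Fin n)) :
    inner ℝ (polarContraction u t x) (polarContraction u t y) =
      ‖x‖ * ‖y‖ * (Real.cos (t * InnerProductGeometry.angle (u : EuclideanSpace ℝ (Fin n)) x) *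
          Real.cos (t * InnerProductGeometry.angle (u : EuclideanSpace ℝ (Fin n)) y) +
        Real.sin (t * InnerProductGeometry.angle (u : EuclideanSpace ℝ (Fin n)) x) *
          Real.sin (t * InnerProductGeometry.angle (u : EuclideanSpace ℝ (Fin n)) y) *
          inner ℝ (meridian u x) (meridian u y)) := by
  have hx : inner ℝ (meridian u x) (u : EuclideanSpace ℝ (Fin n)) = 0 := by
    rw [real_inner_comm, inner_meridian]
  simp only [polarContraction, inner_smul_left, inner_smul_right, inner_add_left,
    inner_add_right, inner_meridian, hx, real_inner_self_eq_norm_sq, norm_eq_of_mem_sphere,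
    RCLike.conj_to_real]
  ring

lemma norm_polarContraction (t : ℝ) {x : EuclideanSpace ℝ (Fin n)}
    (hx : InnerProductGeometry.angle (u : EuclideanSpace ℝ (Fin n)) x < Real.pi) :
    ‖polarContraction u t x‖ = ‖x‖ := by
  rw [← sq_eq_sq₀ (norm_nonneg _) (norm_nonneg _), ← real_inner_self_eq_norm_sq,
    inner_polarContraction, real_inner_self_eq_norm_sq (meridian u x)]
  have h := Real.sin_sq_add_cos_sq
    (t * InnerProductGeometry.angle (u : EuclideanSpace ℝ (Fin n)) x)
  -- the meridian is a unit vector unless `x` points in the direction of `u`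
  rcases (InnerProductGeometry.angle_nonneg (u : EuclideanSpace ℝ (Fin n)) x).eq_or_lt with h0 | h0
  · rw [← h0]
    simp [sq]
  rcases eq_or_ne x 0 with rfl | hx0
  · simp
  have hw : ‖x - inner ℝ (u : EuclideanSpace ℝ (Fin n)) x • (u : EuclideanSpace ℝ (Fin n))‖ ≠ 0 := by
    rw [norm_sub_inner_smul]
    exact (mul_pos (norm_pos_iff.2 hx0) (Real.sin_pos_of_pos_of_lt_pi h0 hx)).ne'
  have h1 : ‖meridian u x‖ = 1 := by
    rw [meridian, norm_smul, norm_inv, norm_norm, inv_mul_cancel₀ hw]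
  rw [h1]
  linear_combination ‖x‖ ^ 2 * h

lemma angle_polarContraction {t : ℝ} (ht0 : 0 ≤ t) (ht1 : t ≤ 1) {x : EuclideanSpace ℝ (Fin n)}
    (hx0 : x ≠ 0) (hx : InnerProductGeometry.angle (u : EuclideanSpace ℝ (Fin n)) x < Real.pi) :
    InnerProductGeometry.angle (u : EuclideanSpace ℝ (Fin n)) (polarContraction u t x) =
      t * InnerProductGeometry.angle (u : EuclideanSpace ℝ (Fin n)) x := by
  have h0 := InnerProductGeometry.angle_nonneg (u : EuclideanSpace ℝ (Fin n)) x
  rw [InnerProductGeometry.angle, norm_polarContraction u t hx, norm_eq_of_mem_sphere,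
    polarContraction, inner_smul_right, inner_add_right, inner_smul_right, inner_smul_right,
    inner_meridian, real_inner_self_eq_norm_sq, norm_eq_of_mem_sphere]
  rw [one_pow, mul_one, mul_zero, add_zero, one_mul,
    mul_div_cancel_left₀ _ (norm_ne_zero_iff.2 hx0),
    Real.arccos_cos (by positivity) (by nlinarith)]

lemma mul_dist_le_dist_polarContraction {t : ℝ} (ht0 : 0 ≤ t) (ht1 : t ≤ 1)
    {x y : EuclideanSpace ℝ (Fin n)}
    (hx : InnerProductGeometry.angle (u : EuclideanSpace ℝ (Fin n)) x < Real.pi)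
    (hy : InnerProductGeometry.angle (u : EuclideanSpace ℝ (Fin n)) y < Real.pi) :
    t * dist x y ≤ dist (polarContraction u t x) (polarContraction u t y) := by
  have hc : inner ℝ (meridian u x) (meridian u y) ≤ 1 :=
    (real_inner_le_norm _ _).trans
      (mul_le_one₀ (norm_meridian_le u x) (norm_nonneg _) (norm_meridian_le u y))
  have h := sq_mul_chord_le ht0 ht1 (InnerProductGeometry.angle_nonneg _ _) hx.le
    (InnerProductGeometry.angle_nonneg _ _) hy.le (norm_nonneg x) (norm_nonneg y) hc
  have h1 := inner_polarContraction u 1 x y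
  rw [polarContraction_one, polarContraction_one, one_mul, one_mul] at h1
  rw [← pow_le_pow_iff_left₀ (by positivity) dist_nonneg two_ne_zero, dist_eq_norm, dist_eq_norm,
    mul_pow, norm_sub_sq_real, norm_sub_sq_real, norm_polarContraction u t hx,
    norm_polarContraction u t hy, h1, inner_polarContraction]
  linarith

/-- The polar contraction multiplies no distance by less than `t`, so it multiplies no volume by
less than `t ^ n`: volume is a multiple of the `n`-dimensional Hausdorff measure. -/
lemma pow_mul_volume_solidSector_le {t φ : ℝ} (ht0 : 0 < t) (ht1 : t ≤ 1) (hφ : φ < Real.pi) :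
    ENNReal.ofReal t ^ n * volume (solidSector u φ) ≤ volume (solidSector u (t * φ)) := by
  have hvol : ∀ s : Set (EuclideanSpace ℝ (Fin n)), volume s =
      (Measure.addHaarScalarFactor (volume : Measure (EuclideanSpace ℝ (Fin n))) (μH[n])) •
        (μH[n] : Measure (EuclideanSpace ℝ (Fin n))) s := by
    intro s
    have hH : (μH[n] : Measure (EuclideanSpace ℝ (Fin n))).IsAddHaarMeasure := by
      simpa using isAddHaarMeasure_hausdorffMeasure (E := EuclideanSpace ℝ (Fin n))
    conv_lhs => rw [Measure.isAddLeftInvariant_eq_smul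
      (volume : Measure (EuclideanSpace ℝ (Fin n))) (μH[n])]
    rfl
  have hanti : AntilipschitzWith (Real.toNNReal t)⁻¹
      ((solidSector u φ).domRestrict (polarContraction u t)) := by
    refine AntilipschitzWith.of_le_mul_dist fun x y => ?_
    have h := mul_dist_le_dist_polarContraction u ht0.le ht1 (x.2.2.2.trans_lt hφ)
      (y.2.2.2.trans_lt hφ)
    rw [NNReal.coe_inv, Real.coe_toNNReal _ ht0.le, inv_mul_eq_div, le_div_iff₀' ht0]
    exact h
  have hle := hanti.le_hausdorffMeasure_image (d := n) (Nat.cast_nonneg n) Set.univ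
  rw [← isometry_subtype_coe.hausdorffMeasure_image (Or.inl (Nat.cast_nonneg n)), Set.image_univ,
    Set.image_univ, Subtype.range_coe, Set.range_domRestrict] at hle
  have hsub : polarContraction u t '' solidSector u φ ⊆ solidSector u (t * φ) := by
    rintro _ ⟨x, ⟨h0, h1, h2⟩, rfl⟩
    have hx := h2.trans_lt hφ
    refine ⟨?_, ?_, ?_⟩
    · rwa [norm_polarContraction u t hx]
    · rwa [norm_polarContraction u t hx]
    · rw [angle_polarContraction u ht0.le ht1 (norm_pos_iff.1 h0) hx]
      gcongr
  have hle' := hle.trans (mul_le_mul_right (measure_mono hsub) _)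
  have ht : (Real.toNNReal t : ENNReal) ≠ 0 := by simpa using ht0
  rw [ENNReal.rpow_natCast, ENNReal.coe_inv (by simpa using ht0), ← ENNReal.inv_pow] at hle'
  have hle2 : ENNReal.ofReal t ^ n * μH[n] (solidSector u φ) ≤ μH[n] (solidSector u (t * φ)) := by
    refine (mul_le_mul_right hle' _).trans_eq ?_
    rw [← mul_assoc, ENNReal.ofReal, ENNReal.mul_inv_cancel (pow_ne_zero _ ht)
      (ENNReal.pow_ne_top ENNReal.coe_ne_top), one_mul]
  rw [hvol, hvol, mul_smul_comm]
  exact smul_le_smul_of_nonneg_left hle2 zero_le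

end Contraction

lemma pow_mul_capMeasure_le {n : ℕ} (u : UnitSphere n) {t φ : ℝ} (ht0 : 0 < t) (ht1 : t ≤ 1)
    (hφ : φ < Real.pi) : t ^ n * capMeasure u φ ≤ capMeasure u (t * φ) := by
  have := isProbabilityMeasure_sphereProb (ne_zero_of_unitSphere u)
  have h : ENNReal.ofReal t ^ n * sphereProb n (sphericalCap u φ) ≤
      sphereProb n (sphericalCap u (t * φ)) := by
    rw [sphereProb_sphericalCap, sphereProb_sphericalCap, mul_left_comm,
      mul_left_comm _ (n : ENNReal)]
    gcongr
    exact pow_mul_volume_solidSector_le u ht0 ht1 hφ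
  have h' := ENNReal.toReal_mono (measure_ne_top _ _) h
  rwa [ENNReal.toReal_mul, ENNReal.toReal_pow, ENNReal.toReal_ofReal ht0.le] at h'

lemma capMeasure_pos {n : ℕ} (u : UnitSphere n) {φ : ℝ} (hφ : 0 < φ) : 0 < capMeasure u φ := by
  have := isProbabilityMeasure_sphereProb (ne_zero_of_unitSphere u)
  have hopen : IsOpen {v : UnitSphere n |
      InnerProductGeometry.angle (u : EuclideanSpace ℝ (Fin n)) v < φ} :=
    isOpen_lt (continuous_angle_right u) continuous_const
  have hpos : 0 < (volume : Measure (EuclideanSpace ℝ (Fin n))).toSphere (sphericalCap u φ) := by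
    refine (hopen.measure_pos _ ⟨u, ?_⟩).trans_le (measure_mono fun v hv => ?_)
    · simpa [InnerProductGeometry.angle_self (ne_zero_of_mem_unit_sphere u)] using hφ
    · rw [Set.mem_ofPred_eq] at hv
      exact hv.le
  refine ENNReal.toReal_pos ?_ (measure_ne_top _ _)
  rw [sphereProb, Measure.smul_apply, smul_eq_mul]
  exact mul_ne_zero (ENNReal.inv_ne_zero.2 (measure_ne_top _ _)) hpos.ne'

lemma pow_mul_capMeasure_le_openCap {n : ℕ} (u : UnitSphere n) {t φ : ℝ} (ht0 : 0 < t)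
    (ht1 : t ≤ 1) (hφ0 : 0 < φ) (hφ : φ < Real.pi) :
    t ^ n * capMeasure u φ ≤ (sphereProb n).real {v : UnitSphere n |
      InnerProductGeometry.angle (u : EuclideanSpace ℝ (Fin n)) v < t * φ} := by
  have := isProbabilityMeasure_sphereProb (ne_zero_of_unitSphere u)
  -- the open cap contains the closed caps of radius `s * φ` for all `s < t`
  have hlim : Filter.Tendsto (fun s : ℝ => s ^ n * capMeasure u φ) (nhdsWithin t (Set.Iio t))
      (nhds (t ^ n * capMeasure u φ)) :=
    (Continuous.tendsto (by fun_prop) t).mono_left nhdsWithin_le_nhds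
  refine le_of_tendsto hlim ?_
  filter_upwards [Ioo_mem_nhdsLT ht0] with s hs
  refine (pow_mul_capMeasure_le u hs.1 (hs.2.le.trans ht1) hφ).trans ?_
  exact measureReal_mono fun v hv => lt_of_le_of_lt hv (mul_lt_mul_of_pos_right hs.2 hφ0)

/-! ### Economical covering by random caps and a saturated packing -/

lemma measurableSet_setOf_angle_le (n : ℕ) (φ : ℝ) :
    MeasurableSet {p : UnitSphere n × UnitSphere n |
      InnerProductGeometry.angle (p.1 : EuclideanSpace ℝ (Fin n)) p.2 ≤ φ} := by
  refine (isClosed_le (continuous_iff_continuousAt.2 fun p => ?_) continuous_const).measurableSet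
  have h := InnerProductGeometry.continuousAt_angle
    (x := ((p.1 : EuclideanSpace ℝ (Fin n)), (p.2 : EuclideanSpace ℝ (Fin n))))
    (ne_zero_of_mem_unit_sphere p.1) (ne_zero_of_mem_unit_sphere p.2)
  exact ContinuousAt.comp (f := fun p : UnitSphere n × UnitSphere n =>
    ((p.1 : EuclideanSpace ℝ (Fin n)), (p.2 : EuclideanSpace ℝ (Fin n)))) h (by fun_prop)

/-- A cap whose centre is uniformly distributed covers, on average, the fraction
`capMeasure u φ` of any given set; hence some cap covers at least this fraction. -/
lemma exists_measureReal_diff_sphericalCap_le {n : ℕ} (u : UnitSphere n) (φ : ℝ)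
    {U : Set (UnitSphere n)} (hU : MeasurableSet U) :
    ∃ x : UnitSphere n, (sphereProb n).real (U \ sphericalCap x φ) ≤
      (1 - capMeasure u φ) * (sphereProb n).real U := by
  have := isProbabilityMeasure_sphereProb (ne_zero_of_unitSphere u)
  set μ := sphereProb n with hμ
  have hmeas : MeasurableSet (Prod.snd ⁻¹' U ∩ {p : UnitSphere n × UnitSphere n |
      InnerProductGeometry.angle (p.1 : EuclideanSpace ℝ (Fin n)) p.2 ≤ φ}) :=
    (measurable_snd hU).inter (measurableSet_setOf_angle_le n φ)
  have h1 := Measure.prod_apply (μ := μ) (ν := μ) hmeas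
  have h2 := Measure.prod_apply_symm (μ := μ) (ν := μ) hmeas
  have h3 : ∀ y : UnitSphere n, μ ((fun x => (x, y)) ⁻¹' (Prod.snd ⁻¹' U ∩
      {p : UnitSphere n × UnitSphere n |
        InnerProductGeometry.angle (p.1 : EuclideanSpace ℝ (Fin n)) p.2 ≤ φ})) =
      U.indicator (fun _ => μ (sphericalCap u φ)) y := by
    intro y
    by_cases hy : y ∈ U
    · rw [Set.indicator_of_mem hy, hμ, sphereProb_sphericalCap_eq u y]
      congr 1
      ext x
      simp [sphericalCap, hy, InnerProductGeometry.angle_comm]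
    · rw [Set.indicator_of_notMem hy, show ((fun x => (x, y)) ⁻¹' (Prod.snd ⁻¹' U ∩
        {p : UnitSphere n × UnitSphere n |
          InnerProductGeometry.angle (p.1 : EuclideanSpace ℝ (Fin n)) p.2 ≤ φ})) = ∅ by
            ext x; simp [hy], measure_empty]
  simp_rw [h3] at h2
  rw [lintegral_indicator hU, lintegral_const, Measure.restrict_apply_univ] at h2
  rw [h1] at h2
  have hne : μ (sphericalCap u φ) * μ U ≠ ⊤ :=
    ENNReal.mul_ne_top (measure_ne_top _ _) (measure_ne_top _ _)
  obtain ⟨x, hx⟩ := exists_lintegral_le (μ := μ) (h2.trans_ne hne)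
  refine ⟨x, ?_⟩
  rw [h2] at hx
  have hx' := ENNReal.toReal_mono (measure_ne_top _ _) hx
  rw [ENNReal.toReal_mul] at hx'
  have h4 := measureReal_inter_add_sdiff (μ := μ) (s := U)
    (isClosed_sphericalCap x φ).measurableSet
  have h5 : capMeasure u φ * μ.real U ≤ μ.real (U ∩ sphericalCap x φ) := hx'
  linarith

lemma isOpen_setOf_forall_lt_angle {n : ℕ} (A : Finset (UnitSphere n)) (φ : ℝ) :
    IsOpen {v : UnitSphere n | ∀ x ∈ A,
      φ < InnerProductGeometry.angle (x : EuclideanSpace ℝ (Fin n)) v} := by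
  have : {v : UnitSphere n | ∀ x ∈ A,
      φ < InnerProductGeometry.angle (x : EuclideanSpace ℝ (Fin n)) v} =
      ⋂ x ∈ A, {v : UnitSphere n |
        φ < InnerProductGeometry.angle (x : EuclideanSpace ℝ (Fin n)) v} := by
    ext v; simp
  rw [this]
  exact isOpen_biInter_finset fun x _ => isOpen_lt continuous_const (continuous_angle_right x)

lemma exists_finset_measureReal_uncovered_le {n : ℕ} (u : UnitSphere n) (φ : ℝ) (N : ℕ) :
    ∃ A : Finset (UnitSphere n), A.card ≤ N ∧ (sphereProb n).real {v : UnitSphere n |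
      ∀ x ∈ A, φ < InnerProductGeometry.angle (x : EuclideanSpace ℝ (Fin n)) v} ≤
        (1 - capMeasure u φ) ^ N := by
  classical
  have := isProbabilityMeasure_sphereProb (ne_zero_of_unitSphere u)
  induction N with
  | zero => exact ⟨∅, by simp, by simp⟩
  | succ N ih =>
    obtain ⟨A, hA, hm⟩ := ih
    obtain ⟨x, hx⟩ := exists_measureReal_diff_sphericalCap_le u φ
      (isOpen_setOf_forall_lt_angle A φ).measurableSet
    refine ⟨insert x A, (Finset.card_insert_le _ _).trans (by omega), ?_⟩
    have h1 : capMeasure u φ ≤ 1 := measureReal_le_one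
    rw [pow_succ']
    refine le_trans (le_trans (le_of_eq ?_) hx)
      (mul_le_mul_of_nonneg_left hm (sub_nonneg.2 h1))
    congr 1
    ext v
    simp [sphericalCap, and_comm]

/-- A maximal family of disjoint open caps of radius `r` inside `U`, given by the set `B` of their
centres: it is finite as each member has measure at least `c`, and by maximality each open cap of
radius `r` inside `U` meets one of its members. -/
lemma exists_saturated_packing {n : ℕ} {U : Set (UnitSphere n)} {r c : ℝ}
    (hc : 0 < c) (hr : ∀ u : UnitSphere n, c ≤ (sphereProb n).real {v : UnitSphere n |
      InnerProductGeometry.angle (u : EuclideanSpace ℝ (Fin n)) v < r}) (hr0 : 0 < r) :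
    ∃ B : Finset (UnitSphere n), B.card * c ≤ (sphereProb n).real U ∧
      ∀ v : UnitSphere n, (∀ w : UnitSphere n,
        InnerProductGeometry.angle (v : EuclideanSpace ℝ (Fin n)) w < r → w ∈ U) →
        ∃ b ∈ B, InnerProductGeometry.angle (b : EuclideanSpace ℝ (Fin n)) v < 2 * r := by
  classical
  rcases eq_or_ne n 0 with rfl | hn
  · refine ⟨∅, by simp, fun v => absurd rfl (ne_zero_of_unitSphere v)⟩
  have := isProbabilityMeasure_sphereProb hn
  set C : UnitSphere n → Set (UnitSphere n) := fun b => {w |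
    InnerProductGeometry.angle (b : EuclideanSpace ℝ (Fin n)) w < r} with hC
  set S : Set ℕ := {k | ∃ B : Finset (UnitSphere n), (∀ b ∈ B, C b ⊆ U) ∧
    (B : Set (UnitSphere n)).PairwiseDisjoint C ∧ B.card = k} with hS
  have hmass : ∀ B : Finset (UnitSphere n), (∀ b ∈ B, C b ⊆ U) →
      (B : Set (UnitSphere n)).PairwiseDisjoint C → B.card * c ≤ (sphereProb n).real U := by
    intro B hB hd
    calc B.card * c = ∑ _b ∈ B, c := by simp
      _ ≤ ∑ b ∈ B, (sphereProb n).real (C b) := Finset.sum_le_sum fun b _ => hr b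
      _ = (sphereProb n).real (⋃ b ∈ B, C b) := (measureReal_biUnion_finset hd fun b _ =>
          (isOpen_lt (continuous_angle_right b) continuous_const).measurableSet).symm
      _ ≤ (sphereProb n).real U := measureReal_mono (Set.iUnion₂_subset hB)
  have hbdd : BddAbove S := by
    refine ⟨⌈(sphereProb n).real U / c⌉₊, ?_⟩
    rintro _ ⟨B, hB, hd, rfl⟩
    have h := (le_div_iff₀ hc).2 (hmass B hB hd)
    exact_mod_cast h.trans (Nat.le_ceil _)
  obtain ⟨B, hB, hd, hcard⟩ := Nat.sSup_mem (s := S) ⟨0, ∅, by simp, by simp, rfl⟩ hbdd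
  refine ⟨B, hmass B hB hd, fun v hv => ?_⟩
  by_contra! hfar
  have hvB : v ∉ B := fun h => by
    have := hfar v h
    rw [InnerProductGeometry.angle_self (ne_zero_of_mem_unit_sphere v)] at this
    linarith
  have hmem : B.card + 1 ∈ S := by
    refine ⟨insert v B, ?_, ?_, Finset.card_insert_of_notMem hvB⟩
    · intro b hb
      rcases Finset.mem_insert.1 hb with rfl | hb
      · exact hv
      · exact hB b hb
    · rw [Finset.coe_insert]
      refine hd.insert_of_notMem (by simpa using hvB) fun b hb => ?_
      refine Set.disjoint_left.2 fun w hw1 hw2 => ?_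
      have h1 := InnerProductGeometry.angle_le_angle_add_angle
        (b : EuclideanSpace ℝ (Fin n)) w v
      have h2 : InnerProductGeometry.angle (v : EuclideanSpace ℝ (Fin n)) w < r := hw1
      have h3 : InnerProductGeometry.angle (b : EuclideanSpace ℝ (Fin n)) w < r := hw2
      rw [InnerProductGeometry.angle_comm] at h2
      linarith [hfar b hb]
  have := le_csSup hbdd hmem
  omega

/-- The numerical inequality behind the choice of the packing radius `ε φ`. The `-2` in `a` pays
for rounding up the number of random caps and for the caps of the packing. -/
lemma exp_neg_le_pow {n : ℕ} (hn : 2 ≤ n) {ε a : ℝ}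
    (hε : ε = 1 / (n * (Real.log n + 1)))
    (ha : a = n * Real.log n + n * Real.log (Real.log n) + 5 * n - 2) :
    0 ≤ a ∧ Real.exp (-((1 - ε) ^ n * a)) ≤ ε ^ n := by
  have hn2 : (2 : ℝ) ≤ n := by exact_mod_cast hn
  have hn0 : (0 : ℝ) < n := by linarith
  set l := Real.log n with hl
  have hl2 : (1 : ℝ) / 2 ≤ l := by
    have := Real.log_le_log two_pos hn2
    have := Real.log_two_gt_d9
    linarith
  have hl0 : 0 < l := by linarith
  have hlog1 : Real.log (l + 1) ≤ l := by
    have := Real.log_le_sub_one_of_pos (show 0 < l + 1 by linarith)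
    linarith
  -- `ln (1 + 1 / l) ≤ 1 / l`
  have hlog2 : l * Real.log (l + 1) ≤ l * Real.log l + 1 := by
    have h := Real.log_le_sub_one_of_pos (show 0 < (l + 1) / l by positivity)
    rw [Real.log_div (by positivity) hl0.ne'] at h
    have h' := mul_le_mul_of_nonneg_left h hl0.le
    have : l * ((l + 1) / l - 1) = 1 := by field_simp; ring
    linarith
  have hkey : (l + 1) * (l + Real.log (l + 1)) ≤ l * (l + Real.log l + 4) := by nlinarith
  have hlogl : 0 ≤ l + Real.log l + 4 := by
    have h := Real.log_nonneg (show 1 ≤ l + 1 by linarith)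
    have : 0 ≤ l * (l + Real.log l + 4) := le_trans (by positivity) hkey
    exact nonneg_of_mul_nonneg_right this hl0
  have ha' : n * (l + Real.log l + 4) ≤ a := by rw [ha]; linarith
  have ha0 : 0 ≤ a := le_trans (by positivity) ha'
  refine ⟨ha0, ?_⟩
  have hε0 : 0 < ε := by rw [hε]; positivity
  have hε1 : ε ≤ 1 := by
    rw [hε]
    exact div_le_one_of_le₀ (by nlinarith) (by positivity)
  -- Bernoulli's inequality
  have hb : l / (l + 1) ≤ (1 - ε) ^ n := by
    have h := one_add_mul_le_pow (show (-2 : ℝ) ≤ -ε by linarith) n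
    have h2 : 1 + (n : ℝ) * -ε = l / (l + 1) := by rw [hε]; field_simp; ring
    rwa [h2, ← sub_eq_add_neg] at h
  have hlogε : Real.log ε = -(l + Real.log (l + 1)) := by
    rw [hε, one_div, Real.log_inv, Real.log_mul hn0.ne' (by positivity)]
  rw [← Real.exp_log (pow_pos hε0 n), Real.exp_le_exp, Real.log_pow, hlogε]
  have h1 : (l + Real.log (l + 1)) ≤ l / (l + 1) * (l + Real.log l + 4) := by
    rw [div_mul_eq_mul_div, le_div_iff₀ (by positivity)]
    linarith
  have h2 := mul_le_mul_of_nonneg_left h1 hn0.le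
  have h3 : n * (l / (l + 1) * (l + Real.log l + 4)) ≤ (1 - ε) ^ n * a := by
    calc n * (l / (l + 1) * (l + Real.log l + 4))
        = l / (l + 1) * (n * (l + Real.log l + 4)) := by ring
      _ ≤ (1 - ε) ^ n * a := mul_le_mul hb ha' (by positivity) (le_trans (by positivity) hb)
  linarith

/-- The economical covering of the sphere by open caps of angular radius `φ`: caps of radius
`(1 - ε) φ` with well-chosen centres leave a small set uncovered, and a saturated packing of that
set by caps of radius `ε φ` supplies the remaining centres. -/
lemma exists_finset_forall_angle_lt {n : ℕ} (hn : 2 ≤ n) (u : UnitSphere n) {φ : ℝ} (hφ0 : 0 < φ)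
    (hφ : φ < Real.pi) :
    ∃ A : Finset (UnitSphere n),
      (A.card : ℝ) ≤ ((n : ℝ) * Real.log n + (n : ℝ) * Real.log (Real.log n) + 5 * (n : ℝ)) /
        capMeasure u φ ∧
      ∀ v : UnitSphere n, ∃ x ∈ A,
        InnerProductGeometry.angle (x : EuclideanSpace ℝ (Fin n)) v < φ := by
  classical
  have := isProbabilityMeasure_sphereProb (ne_zero_of_unitSphere u)
  have hn2 : (2 : ℝ) ≤ n := by exact_mod_cast hn
  have hl : 0 < Real.log n := Real.log_pos (by linarith)
  set ε : ℝ := 1 / (n * (Real.log n + 1)) with hε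
  set a : ℝ := n * Real.log n + n * Real.log (Real.log n) + 5 * n - 2 with ha
  obtain ⟨ha0, hexp⟩ := exp_neg_le_pow hn hε ha
  have hε0 : 0 < ε := by positivity
  have hε2 : 2 * ε ≤ 1 := by
    rw [hε, mul_one_div, div_le_one (by positivity)]
    nlinarith
  set c := capMeasure u φ with hc
  have hc0 : 0 < c := capMeasure_pos u hφ0
  have hc1 : c ≤ 1 := measureReal_le_one
  set N := ⌈a / c⌉₊ with hN
  obtain ⟨A, hA, hmA⟩ := exists_finset_measureReal_uncovered_le u ((1 - ε) * φ) N
  obtain ⟨B, hB, hsat⟩ := exists_saturated_packing (U := {v : UnitSphere n |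
      ∀ x ∈ A, (1 - ε) * φ < InnerProductGeometry.angle (x : EuclideanSpace ℝ (Fin n)) v})
    (r := ε * φ) (c := ε ^ n * c) (by positivity) (fun x => by
      rw [hc, capMeasure_eq u x]
      exact pow_mul_capMeasure_le_openCap x hε0 (by linarith) hφ0 hφ) (by positivity)
  refine ⟨A ∪ B, ?_, fun v => ?_⟩
  · have hp := pow_mul_capMeasure_le u (t := 1 - ε) (by linarith) (by linarith) hφ
    have hp1 : capMeasure u ((1 - ε) * φ) ≤ 1 := measureReal_le_one
    have hNc : a ≤ N * c := (div_le_iff₀ hc0).1 (Nat.le_ceil _)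
    have h1 : (1 - capMeasure u ((1 - ε) * φ)) ^ N ≤ ε ^ n := by
      calc (1 - capMeasure u ((1 - ε) * φ)) ^ N
          ≤ (Real.exp (-capMeasure u ((1 - ε) * φ))) ^ N :=
            pow_le_pow_left₀ (by linarith) (Real.one_sub_le_exp_neg _) N
        _ = Real.exp (-(N * capMeasure u ((1 - ε) * φ))) := by
            rw [← Real.exp_nat_mul, mul_neg]
        _ ≤ Real.exp (-((1 - ε) ^ n * a)) := by
            rw [Real.exp_le_exp, neg_le_neg_iff]
            calc (1 - ε) ^ n * a ≤ (1 - ε) ^ n * (N * c) :=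
                  mul_le_mul_of_nonneg_left hNc (pow_nonneg (by linarith) n)
              _ = N * ((1 - ε) ^ n * c) := by ring
              _ ≤ N * capMeasure u ((1 - ε) * φ) :=
                  mul_le_mul_of_nonneg_left hp (Nat.cast_nonneg N)
        _ ≤ ε ^ n := hexp
    -- the packing bound is `B.card * (ε ^ n * c) ≤ ε ^ n`
    have hBc : B.card * c ≤ 1 := by
      have h := (hB.trans hmA).trans h1
      have hpos := pow_pos hε0 n
      refine le_of_mul_le_mul_left ?_ hpos
      linarith
    have hNc' : N * c ≤ a + 1 := by
      have h := Nat.ceil_lt_add_one (div_nonneg ha0 hc0.le)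
      have h' := mul_le_mul_of_nonneg_right h.le hc0.le
      rw [add_mul, div_mul_cancel₀ _ hc0.ne', one_mul] at h'
      linarith
    have hcard : ((A ∪ B).card : ℝ) ≤ N + B.card := by
      exact_mod_cast (Finset.card_union_le A B).trans (Nat.add_le_add_right hA _)
    rw [le_div_iff₀ hc0]
    have := mul_le_mul_of_nonneg_right hcard hc0.le
    linarith
  -- either the open cap of radius `ε φ` around `v` meets a cap of radius `(1 - ε) φ` around a
  -- point of `A`, or it meets a member of the packing, and `2 ε φ ≤ φ`
  · by_cases hv : ∀ w : UnitSphere n,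
        InnerProductGeometry.angle (v : EuclideanSpace ℝ (Fin n)) w < ε * φ →
        w ∈ {v : UnitSphere n | ∀ x ∈ A,
          (1 - ε) * φ < InnerProductGeometry.angle (x : EuclideanSpace ℝ (Fin n)) v}
    · obtain ⟨b, hb, hbv⟩ := hsat v hv
      exact ⟨b, Finset.mem_union_right _ hb, hbv.trans_le (by nlinarith)⟩
    · push Not at hv
      obtain ⟨w, hvw, hw⟩ := hv
      simp only [Set.mem_ofPred_eq, not_forall, not_lt] at hw
      obtain ⟨x, hx, hxw⟩ := hw
      refine ⟨x, Finset.mem_union_left _ hx, ?_⟩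
      have h := InnerProductGeometry.angle_le_angle_add_angle (x : EuclideanSpace ℝ (Fin n)) w v
      rw [InnerProductGeometry.angle_comm (w : EuclideanSpace ℝ (Fin n))] at h
      linarith

/-! ### From directions to illumination -/

/-- A ray from `b` that makes an angle less than `arcsin r` with the direction of the origin
meets the open ball of radius `r`, namely in its point closest to the origin. -/
lemma illuminates_of_angle_lt_arcsin {n : ℕ} {K : Set (EuclideanSpace ℝ (Fin n))} {r : ℝ}
    (hr0 : 0 ≤ r) (hr1 : r ≤ 1)
    (hK : ball (0 : EuclideanSpace ℝ (Fin n)) r ⊆ interior K) {b : EuclideanSpace ℝ (Fin n)}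
    (hb0 : b ≠ 0) (hb1 : ‖b‖ ≤ 1) (w : UnitSphere n)
    (hw : InnerProductGeometry.angle (w : EuclideanSpace ℝ (Fin n)) (-b) < Real.arcsin r) :
    Illuminates K w b := by
  set θ := InnerProductGeometry.angle (w : EuclideanSpace ℝ (Fin n)) (-b) with hθ
  have hθ0 : 0 ≤ θ := InnerProductGeometry.angle_nonneg _ _
  have hθ1 := hw.trans_le (Real.arcsin_le_pi_div_two r)
  have hcos : Real.cos θ * ‖b‖ = -inner ℝ b (w : EuclideanSpace ℝ (Fin n)) := by
    have h := InnerProductGeometry.cos_angle_mul_norm_mul_norm (w : EuclideanSpace ℝ (Fin n)) (-b)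
    rw [norm_eq_of_mem_sphere, one_mul, norm_neg, inner_neg_right, real_inner_comm] at h
    exact h
  have hbpos := norm_pos_iff.2 hb0
  refine ⟨Real.cos θ * ‖b‖,
    mul_pos (Real.cos_pos_of_mem_Ioo ⟨by linarith [Real.pi_pos], hθ1⟩) hbpos, hK ?_⟩
  have hsin0 : 0 ≤ Real.sin θ := InnerProductGeometry.sin_angle_nonneg _ _
  have hsin : Real.sin θ < r := by
    rw [← Real.sin_arcsin (by linarith) hr1]
    exact Real.sin_lt_sin_of_lt_of_le_pi_div_two (by linarith [Real.pi_pos])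
      (Real.arcsin_le_pi_div_two r) hw
  rw [mem_ball_zero_iff]
  have hnorm : ‖b + (Real.cos θ * ‖b‖) • (w : EuclideanSpace ℝ (Fin n))‖ = ‖b‖ * Real.sin θ := by
    rw [← sq_eq_sq₀ (norm_nonneg _) (by positivity), norm_add_sq_real, inner_smul_right,
      norm_smul, norm_eq_of_mem_sphere, mul_one, Real.norm_eq_abs, sq_abs, mul_pow _ (Real.sin θ),
      Real.sin_sq]
    linear_combination 2 * Real.cos θ * ‖b‖ * hcos
  rw [hnorm]
  nlinarith

lemma illuminationNumber_le_card {n : ℕ} {K : Set (EuclideanSpace ℝ (Fin n))}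
    {A : Finset (UnitSphere n)} (hA : IlluminatedBy K A) : illuminationNumber K ≤ A.card :=
  sInf_le ⟨A, hA, Set.encard_coe_eq_coe_finsetCard A⟩

theorem theorem2 (n : ℕ) (hn : 2 ≤ n) (K : Set (EuclideanSpace ℝ (Fin n))) (hK : IsConvexBody K)
    (D : ℝ) (hD : 1 < D)
    (hinner : Metric.closedBall (0 : EuclideanSpace ℝ (Fin n)) (1 / D) ⊆ K)
    (houter : K ⊆ Metric.closedBall (0 : EuclideanSpace ℝ (Fin n)) 1)
    (u : UnitSphere n) :
    ∃ N : ℕ, illuminationNumber K = (N : ℕ∞) ∧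
      (N : ℝ) ≤ ((n : ℝ) * Real.log n + (n : ℝ) * Real.log (Real.log n) + 5 * (n : ℝ)) /
        capMeasure u (Real.arcsin (1 / D)) := by
  have hD0 : 0 < 1 / D := by positivity
  have hD1 : 1 / D ≤ 1 := (div_le_one (by linarith)).2 hD.le
  obtain ⟨A, hcard, hA⟩ := exists_finset_forall_angle_lt hn u (Real.arcsin_pos.2 hD0)
    ((Real.arcsin_le_pi_div_two _).trans_lt (by linarith [Real.pi_pos]))
  have hball : ball (0 : EuclideanSpace ℝ (Fin n)) (1 / D) ⊆ interior K :=
    interior_maximal (ball_subset_closedBall.trans hinner) isOpen_ball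
  have hill : IlluminatedBy K A := by
    intro b hb
    have hb0 : b ≠ 0 := by
      rintro rfl
      exact hb.2 (hball (mem_ball_self hD0))
    have hb1 : ‖b‖ ≤ 1 := by
      simpa using houter (hK.isCompact.isClosed.frontier_subset hb)
    have hbpos := norm_pos_iff.2 hb0
    obtain ⟨w, hw, hwb⟩ := hA ⟨‖b‖⁻¹ • -b, by
      rw [mem_sphere_zero_iff_norm, norm_smul, norm_inv, norm_norm, norm_neg,
        inv_mul_cancel₀ hbpos.ne']⟩
    refine ⟨w, hw, illuminates_of_angle_lt_arcsin hD0.le hD1 hball hb0 hb1 w ?_⟩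
    rwa [InnerProductGeometry.angle_smul_right_of_pos _ _ (inv_pos.2 hbpos)] at hwb
  have hle := illuminationNumber_le_card hill
  obtain ⟨N, hN⟩ := ENat.ne_top_iff_exists.1 (ne_top_of_le_ne_top (ENat.natCast_ne_top _) hle)
  refine ⟨N, hN.symm, le_trans ?_ hcard⟩
  rw [← hN] at hle
  exact_mod_cast hle
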